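/- Let $\widehat{\mathbb R}=\mathbb R\cup\{\infty\}$. For an infinite string $s\in\{0,1\}^{\mathbb N}$ consisting of $n_0$ letters $0$, then $n_1$ letters $1$, then $n_2$ letters $0$, and so on ($n_0\ge 0$, $n_i\ge 1$ for $i\ge1$, the last block possibly infinite), let $[s]\in[0,\infty]$ be the continued fraction $[n_0,n_1,n_2,\dots]=n_0+\cfrac1{n_1+\cfrac1{n_2+\cdots}}$ (an infinite last block giving the last entry $\infty$). An end of the planar Farey tree, viewed as a path from the base edge, is either such a string $s$ or $Ss$ with such a string $s$ (letters $0$, $1$ for left and right turns); the point of $\widehat{\mathbb R}$ under it is $[s]$ in the first case and $-1/[s]$ in the second. There is exactly one end over each irrational number and there are exactly two over each element of $\mathbb Q\cup\{\infty\}$. Define an involution $\mathbf j_\partial$ of the set of ends by term-wise exclusive or, $$\mathbf j_\partial(s)=s\veebar 010101\dots,\qquad \mathbf j_\partial(Ss)=S\,(s\veebar 101010\dots).$$ A value of jimm at $x\in\widehat{\mathbb R}$ is a point under $\mathbf j_\partial(e)$, where $e$ is an end over $x$. Thus jimm is single-valued at irrational numbers (if $n_0\geq 1$ and $n_i\ge2$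 for $i\geq 1$, it sends $[n_0,n_1,n_2,\dots]$ to $[1_{n_0-1},2,1_{n_1-2},2,1_{n_2-2},\dots]$, where $1_k$ stands for $k$ consecutive entries $1$), and two-valued at rational numbers and at $\infty$. A determination $\mathbf j_{\mathbb R}:\widehat{\mathbb R}\to\widehat{\mathbb R}$ of jimm is a map obtained by choosing, at each point, one of the values of jimm there. **Theorem.** (i) For Lebesgue-almost every $a\in\mathbb R$, every determination $\mathbf j_{\mathbb R}$ of jimm is finite in a neighbourhood of $a$, is differentiable at $a$, and satisfies $\mathbf j_{\mathbb R}'(a)=0$; the exceptional null set does not depend on the determination. (ii) For every integer $n>4$ the same holds at the point $a=[0,n,n,n,\dots]$: every determination $\mathbf j_{\mathbb R}$ of jimm is finite in a neighbourhood of $a$, is differentiable at $a$, and satisfies $\mathbf j_{\mathbb R}'(a)=0$. -/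

import Mathlib

open Filter Topology MeasureTheory

namespace Jimm

/-- The projective real line, the one-point compactification of the reals. -/
abbrev RHat : Type := OnePoint ℝ

/-- The ends of the planar Farey tree, each given by the unique non-backtracking path that
represents it and starts at the base edge `I`. The path leaves the base edge either through the
positive side or, after a first step `S`, through the negative side (`neg = true`). At the `i`-th
trivalent vertex met after that it makes a left turn `LS` (`turn i = false`, the letter `0`) or a
right turn `L²S` (`turn i = true`, the letter `1`). -/
@[ext]
structure FareyEnd where
  neg : Bool
  turn : ℕ → Bool

/-- The action of one turn on `[0, ∞]`. The left turn `LS` acts as `x ↦ 1 + x`, the right turn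
`L²S` as `x ↦ x / (1 + x) = 1 / (1 + 1 / x)`, with `1 / 0 = ∞` and `1 / ∞ = 0`. -/
noncomputable def turnMap : Bool → ENNReal → ENNReal
  | false, x => 1 + x
  | true, x => (1 + x⁻¹)⁻¹

/-- The left end point `W(0)` of the Farey interval `W([0, ∞])`, where `W` is the product of the
first `n` turns of `s`. -/
noncomputable def fareyLeft : ℕ → (ℕ → Bool) → ENNReal
  | 0, _ => 0
  | n + 1, s => turnMap (s 0) (fareyLeft n fun i => s (i + 1))

/-- The point of `[0, ∞]` given by an infinite sequence of turns, as the limit (the supremum) of the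
increasing sequence of left end points of its Farey intervals. If `s` consists of `n₀` letters `0`,
`n₁` letters `1`, `n₂` letters `0`, and so on, this is the continued fraction `[n₀, n₁, n₂, …]`
(where the last block may be infinite, with last entry `∞`). -/
noncomputable def turnValue (s : ℕ → Bool) : ENNReal := ⨆ n, fareyLeft n s

/-- The inclusion of `[0, ∞]` in the projective line. -/
noncomputable def toRHat (v : ENNReal) : RHat :=
  if v = ⊤ then OnePoint.infty else ((v.toReal : ℝ) : RHat)

/-- The continued fraction map from the ends of the Farey tree to the projective line. The initial
letter `S` acts as `x ↦ -1 / x`. -/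
noncomputable def cfm (e : FareyEnd) : RHat :=
  match e.neg with
  | false => toRHat (turnValue e.turn)
  | true => (toRHat (turnValue e.turn)⁻¹).map (fun x : ℝ => -x)

/-- The boundary homeomorphism induced by the tree automorphism that twists every trivalent vertex
except the vertex `v*` next to the base edge on the positive side. A twist at a vertex exchanges left
and right at that vertex and at all its descendants, so the `i`-th turn (counted from `0`) is
reversed `i` times on the positive side and `i + 1` times on the negative side: the string of turns
is xored with `010101…` and with `101010…`, respectively. -/
def jimmEnd (e : FareyEnd) : FareyEnd where
  neg := e.neg
  turn i := xor (e.turn i) (Nat.bodd (if e.neg then i + 1 else i))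

/-- `y` is a value of jimm at `x`: some end over `x` is mapped by `jimmEnd` to an end over `y`.
There is a single end over an irrational `x`, and there are two over a rational `x` or `∞`. -/
def IsJimmValue (x y : RHat) : Prop := ∃ e : FareyEnd, cfm e = x ∧ cfm (jimmEnd e) = y

/-- A determination of the map jimm on the projective line: at each point a value of jimm is
chosen. There is a choice only at rational points and at `∞`. -/
def IsJimm (f : RHat → RHat) : Prop := ∀ x, IsJimmValue x (f x)

/-- The finite value of a point of the projective line (`0` for the point at infinity). -/
def finitePart (y : RHat) : ℝ := y.elim 0 id

/-- The map `f` of the projective line takes finite values near the real point `a`, and the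
real function it defines near `a` has derivative `f'` at `a`. -/
def HasFiniteDerivAt (f : RHat → RHat) (f' a : ℝ) : Prop :=
  (∀ᶠ x : ℝ in 𝓝 a, f (x : RHat) ≠ OnePoint.infty) ∧
    HasDerivAt (fun x : ℝ => finitePart (f (x : RHat))) f' a

/-- The continued fraction `[0; n, n, n, …]`. -/
noncomputable def constContFract (n : ℕ) : GenContFract ℝ where
  h := 0
  s := Stream'.Seq.ofStream (Stream'.const ⟨1, (n : ℝ)⟩)

/-! Every point of the projective line lies under an end, so determinations of jimm exist. -/

lemma turnMap_mono (b : Bool) : Monotone (turnMap b) := by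
  intro x y h
  cases b
  · exact add_le_add_right h 1
  · exact ENNReal.inv_le_inv.2 (add_le_add_right (ENNReal.inv_le_inv.2 h) 1)

lemma fareyLeft_le_succ (n : ℕ) : ∀ s : ℕ → Bool, fareyLeft n s ≤ fareyLeft (n + 1) s := by
  induction n with
  | zero => intro s; exact zero_le
  | succ n ih => intro s; exact turnMap_mono _ (ih _)

lemma turnValue_eq (s : ℕ → Bool) :
    turnValue s = turnMap (s 0) (turnValue fun i => s (i + 1)) := by
  have h1 : turnValue s = ⨆ n, fareyLeft (n + 1) s := by
    apply le_antisymm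
    · exact iSup_le fun n => (fareyLeft_le_succ n s).trans (le_iSup (fun n => fareyLeft (n + 1) s) n)
    · exact iSup_le fun n => le_iSup (fun n => fareyLeft n s) (n + 1)
  rw [h1]
  change (⨆ n, turnMap (s 0) (fareyLeft n fun i => s (i + 1))) = _
  cases s 0
  · exact (ENNReal.add_iSup _).symm
  · simp only [turnMap, turnValue, ENNReal.inv_iSup, ENNReal.add_iInf, ENNReal.inv_iInf]

/-- The first turn towards a point of `[0, ∞]`. -/
noncomputable def firstTurn (x : ENNReal) : Bool := if 1 ≤ x then false else true

/-- What remains of a point of `[0, ∞]` after its first turn. -/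
noncomputable def restOf (x : ENNReal) : ENNReal := if 1 ≤ x then x - 1 else (x⁻¹ - 1)⁻¹

/-- A sequence of turns leading to a given point of `[0, ∞]`. -/
noncomputable def pathTo (x : ENNReal) (i : ℕ) : Bool := firstTurn (restOf^[i] x)

lemma turnMap_firstTurn (x : ENNReal) : turnMap (firstTurn x) (restOf x) = x := by
  unfold firstTurn restOf
  split_ifs with h
  · exact add_tsub_cancel_of_le h
  · have h1 : 1 ≤ x⁻¹ := ENNReal.one_le_inv.2 (not_le.1 h).le
    simp only [turnMap, inv_inv, add_tsub_cancel_of_le h1]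

lemma fareyLeft_pathTo_le (n : ℕ) : ∀ x : ENNReal, fareyLeft n (pathTo x) ≤ x := by
  induction n with
  | zero => intro x; exact zero_le
  | succ n ih =>
    intro x
    calc fareyLeft (n + 1) (pathTo x)
        = turnMap (firstTurn x) (fareyLeft n (pathTo (restOf x))) := rfl
      _ ≤ turnMap (firstTurn x) (restOf x) := turnMap_mono _ (ih _)
      _ = x := turnMap_firstTurn x

lemma turnValue_pathTo_eq (x : ENNReal) :
    turnValue (pathTo x) = turnMap (firstTurn x) (turnValue (pathTo (restOf x))) :=
  turnValue_eq _

lemma no_fraction_between (N : ℕ) : ∀ (p q : ℕ) (x : ENNReal), p + q ≤ N → 0 < q →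
    turnValue (pathTo x) < (p : ENNReal) / q → (p : ENNReal) / q < x → False := by
  induction N with
  | zero => intro p q x h hq; omega
  | succ N ih =>
    intro p q x hN hq h1 h2
    have hq0 : (q : ENNReal) ≠ 0 := by exact_mod_cast hq.ne'
    have hqt : (q : ENNReal) ≠ ⊤ := ENNReal.natCast_ne_top q
    have hp : 0 < p := by
      rcases Nat.eq_zero_or_pos p with rfl | h
      · simp at h1
      · exact h
    have hp0 : (p : ENNReal) ≠ 0 := by exact_mod_cast hp.ne'
    have hpt : (p : ENNReal) ≠ ⊤ := ENNReal.natCast_ne_top p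
    have hx := turnMap_firstTurn x
    rw [turnValue_pathTo_eq] at h1
    rw [← hx] at h2
    cases hb : firstTurn x
    · rw [hb] at h1 h2
      simp only [turnMap] at h1 h2
      have hlt : (1 : ENNReal) < p / q := lt_of_le_of_lt le_self_add h1
      have hpq : q < p := by
        rw [ENNReal.lt_div_iff_mul_lt (Or.inl hq0) (Or.inl hqt), one_mul] at hlt
        exact_mod_cast hlt
      have he : (p : ENNReal) / q = 1 + ((p - q : ℕ) : ENNReal) / q := by
        rw [← ENNReal.div_self hq0 hqt, ← ENNReal.add_div, ← Nat.cast_add,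
          Nat.add_sub_cancel' hpq.le]
      rw [he] at h1 h2
      exact ih (p - q) q (restOf x) (by omega) hq
        (lt_of_add_lt_add_left h1) (lt_of_add_lt_add_left h2)
    · rw [hb] at h1 h2
      simp only [turnMap] at h1 h2
      have hi : ((p : ENNReal) / q)⁻¹ = q / p := ENNReal.inv_div (Or.inl hqt) (Or.inl hq0)
      have h1' := ENNReal.inv_lt_inv.2 h1
      have h2' := ENNReal.inv_lt_inv.2 h2
      rw [hi, inv_inv] at h1' h2'
      have hlt : (1 : ENNReal) < q / p := lt_of_le_of_lt le_self_add h2'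
      have hpq : p < q := by
        rw [ENNReal.lt_div_iff_mul_lt (Or.inl hp0) (Or.inl hpt), one_mul] at hlt
        exact_mod_cast hlt
      have he : (q : ENNReal) / p = 1 + ((q - p : ℕ) : ENNReal) / p := by
        rw [← ENNReal.div_self hp0 hpt, ← ENNReal.add_div, ← Nat.cast_add,
          Nat.add_sub_cancel' hpq.le]
      rw [he] at h1' h2'
      have hr0 : ((q - p : ℕ) : ENNReal) ≠ 0 := by
        have : q - p ≠ 0 := by omega
        exact_mod_cast this
      have hj : (((q - p : ℕ) : ENNReal) / p)⁻¹ = p / (q - p : ℕ) :=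
        ENNReal.inv_div (Or.inl hpt) (Or.inl hp0)
      have h3 := ENNReal.inv_lt_inv.2 (lt_of_add_lt_add_left h1')
      have h4 := ENNReal.inv_lt_inv.2 (lt_of_add_lt_add_left h2')
      rw [hj, inv_inv] at h3 h4
      exact ih p (q - p) (restOf x) (by omega) (by omega) h3 h4

lemma turnValue_pathTo (x : ENNReal) : turnValue (pathTo x) = x := by
  apply le_antisymm
  · exact iSup_le fun n => fareyLeft_pathTo_le n x
  · by_contra h
    obtain ⟨r, h1, h2⟩ := ENNReal.lt_iff_exists_nnreal_btwn.1 (not_le.1 h)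
    obtain ⟨r', h1', h2'⟩ := ENNReal.lt_iff_exists_nnreal_btwn.1 h2
    have hr : (r : ℝ) < r' := by exact_mod_cast h1'
    obtain ⟨c, hc1, hc2⟩ := exists_rat_btwn hr
    have hc0 : 0 ≤ c := by
      have : (0 : ℝ) ≤ c := r.2.trans hc1.le
      exact_mod_cast this
    have hce : ENNReal.ofReal (c : ℝ) = (c.num.toNat : ENNReal) / c.den := by
      have hn : ((c.num.toNat : ℕ) : ℤ) = c.num := Int.toNat_of_nonneg (Rat.num_nonneg.2 hc0)
      have hcr : (c : ℝ) = (c.num.toNat : ℝ) / c.den := by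
        rw [← Int.cast_natCast (R := ℝ) c.num.toNat, hn]
        exact Rat.cast_def c
      rw [hcr, ENNReal.ofReal_div_of_pos (by exact_mod_cast c.den_pos), ENNReal.ofReal_natCast,
        ENNReal.ofReal_natCast]
    have e1 : turnValue (pathTo x) < ENNReal.ofReal (c : ℝ) := by
      refine h1.trans_le ?_
      rw [← ENNReal.ofReal_coe_nnreal]
      exact ENNReal.ofReal_le_ofReal hc1.le
    have e2 : ENNReal.ofReal (c : ℝ) < x := by
      refine lt_of_le_of_lt ?_ h2'
      rw [← ENNReal.ofReal_coe_nnreal]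
      exact ENNReal.ofReal_le_ofReal hc2.le
    rw [hce] at e1 e2
    exact no_fraction_between _ _ _ x le_rfl c.den_pos e1 e2

theorem cfm_surjective : Function.Surjective cfm := by
  intro y
  induction y using OnePoint.rec with
  | infty => exact ⟨⟨false, pathTo ⊤⟩, by simp [cfm, turnValue_pathTo, toRHat]⟩
  | coe y =>
    rcases le_or_gt 0 y with h | h
    · exact ⟨⟨false, pathTo (ENNReal.ofReal y)⟩, by
        simp [cfm, turnValue_pathTo, toRHat, ENNReal.toReal_ofReal h]⟩
    · refine ⟨⟨true, pathTo (ENNReal.ofReal (-y))⁻¹⟩, ?_⟩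
      simp [cfm, turnValue_pathTo, toRHat, ENNReal.toReal_ofReal (neg_pos.2 h).le]

theorem exists_isJimm : ∃ f : RHat → RHat, IsJimm f :=
  ⟨fun x => cfm (jimmEnd (cfm_surjective x).choose),
    fun x => ⟨_, (cfm_surjective x).choose_spec, rfl⟩⟩

end Jimm

namespace Jimm

/-! In the coordinate 1/(1 + x) a path of turns describes nested Farey intervals of [0, 1], each cut
at its mediant, and inversion becomes y ↦ 1 - y. Jimm becomes `chiTwist`, which reverses orientation
at every step. If a path t leaves s at step n, the n-th mediant of s separates their points, so
these are at least as far apart as the point of s is from that mediant, while the images differ by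
at most `twistLength s n`. The derivative therefore vanishes once `twistLength` is negligible
against the distance to the mediant (`Flat`, `Flat.exists_dist_le`). The estimate holds for every
path t, so the choice of end over nearby rationals is immaterial.

For (i), the lengths of the Farey intervals and of their images are two probability distributions on
words of n turns. The twist makes them disagree, in a uniform way, over any two consecutive turns,
so their Hellinger affinity decays geometrically (`affinityFactor_lt_one`, `summable_affinity`). It
bounds the measure of the points violating flatness at level n (`volume_badSet_le`), and
Borel–Cantelli gives `ae_flat`.

For (ii), rates are compared over a block of n equal turns: the Farey denominators grow by a factor
of at most n + 1/n, the product of the image denominators by at least n² + 3 (a Fibonacci estimate),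
and (n + 1/n)² < n² + 3. This gives `flat_of_chiPath_eq`. -/

/-! ### The coordinate on [0, 1] and the action of turns -/

/-- The coordinate `v ↦ 1 / (1 + v)` identifying `[0, ∞]` with `[0, 1]`. -/
noncomputable def chi (v : ENNReal) : ℝ := ((1 + v)⁻¹).toReal

/-- The action of one turn in the coordinate `chi`. -/
noncomputable def turnChi : Bool → ℝ → ℝ
  | false, y => y / (1 + y)
  | true, y => 1 / (2 - y)

/-- The sequence of turns that remains after the first `n` of them. -/
def shift (n : ℕ) (s : ℕ → Bool) : ℕ → Bool := fun i => s (n + i)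

/-- The point of `[0, 1]` with a given sequence of turns. -/
noncomputable def chiPath (s : ℕ → Bool) : ℝ := chi (turnValue s)

/-- The image under jimm of the point with a given sequence of turns. -/
noncomputable def chiTwist (s : ℕ → Bool) : ℝ := chiPath fun i => xor (s i) (Nat.bodd i)

lemma chi_top : chi ⊤ = 0 := by simp [chi]

lemma chi_ofReal {x : ℝ} (hx : 0 ≤ x) : chi (ENNReal.ofReal x) = 1 / (1 + x) := by
  rw [chi, ENNReal.toReal_inv, ENNReal.toReal_add (by simp) (by simp), ENNReal.toReal_ofReal hx]
  simp

lemma chi_nonneg (v : ENNReal) : 0 ≤ chi v := ENNReal.toReal_nonneg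

lemma chi_le_one (v : ENNReal) : chi v ≤ 1 := by
  have : (1 + v)⁻¹ ≤ 1 := ENNReal.inv_le_one.2 le_self_add
  simpa [chi] using ENNReal.toReal_mono (by simp) this

lemma chi_inv (v : ENNReal) : chi v⁻¹ = 1 - chi v := by
  induction v using ENNReal.recTopCoe with
  | top => simp [chi]
  | coe x =>
    rcases eq_or_ne x 0 with rfl | hx
    · simp [chi]
    · have hx' : (0 : ℝ) < x := by positivity
      have h : (x : ENNReal) = ENNReal.ofReal (x : ℝ) := by simp
      rw [h, ← ENNReal.ofReal_inv_of_pos hx', chi_ofReal hx'.le, chi_ofReal (by positivity)]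
      field_simp
      ring

lemma chi_turnMap (b : Bool) (v : ENNReal) : chi (turnMap b v) = turnChi b (chi v) := by
  have key : ∀ w, chi (1 + w) = chi w / (1 + chi w) := by
    intro w
    induction w using ENNReal.recTopCoe with
    | top => simp [chi]
    | coe x =>
      have h : (x : ENNReal) = ENNReal.ofReal (x : ℝ) := by simp
      have h0 : (0 : ℝ) ≤ x := x.2
      have h1 : (1 : ENNReal) + x = ENNReal.ofReal (1 + x) := by
        rw [ENNReal.ofReal_add zero_le_one h0]; simp
      rw [h1, h, chi_ofReal h0, chi_ofReal (by positivity)]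
      field_simp
      ring
  cases b
  · exact key v
  · have h1 : (1 + (1 - chi v)) ≠ 0 := by linarith [chi_le_one v]
    have h2 : 2 - chi v ≠ 0 := by linarith [chi_le_one v]
    simp only [turnMap, turnChi]
    rw [chi_inv, key, chi_inv]
    field_simp
    ring

lemma chiPath_nonneg (s : ℕ → Bool) : 0 ≤ chiPath s := chi_nonneg _

lemma chiPath_le_one (s : ℕ → Bool) : chiPath s ≤ 1 := chi_le_one _

lemma chiTwist_nonneg (s : ℕ → Bool) : 0 ≤ chiTwist s := chi_nonneg _

lemma chiTwist_le_one (s : ℕ → Bool) : chiTwist s ≤ 1 := chi_le_one _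

lemma shift_zero (s : ℕ → Bool) : shift 0 s = s := by
  funext i; simp [shift]

lemma shift_shift (m n : ℕ) (s : ℕ → Bool) : shift m (shift n s) = shift (n + m) s := by
  funext i; simp [shift, add_assoc]

lemma chiPath_eq (s : ℕ → Bool) : chiPath s = turnChi (s 0) (chiPath (shift 1 s)) := by
  have h : shift 1 s = fun i => s (i + 1) := by funext i; simp [shift, add_comm]
  rw [chiPath, turnValue_eq, chi_turnMap, h, chiPath]

/-! ### Möbius transformations along a path -/

/-- A Möbius transformation of `[0, 1]` in the homogeneous coordinates `(1 - y : y)`: its image has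
end points `c / u` and `d / v`. -/
structure Moebius where
  c : ℝ
  d : ℝ
  u : ℝ
  v : ℝ

namespace Moebius

/-- The value of a Möbius transformation at a point of `[0, 1]`. -/
noncomputable def eval (M : Moebius) (y : ℝ) : ℝ :=
  (M.c * (1 - y) + M.d * y) / (M.u * (1 - y) + M.v * y)

/-- The determinant of a Möbius transformation. -/
def det (M : Moebius) : ℝ := M.d * M.u - M.c * M.v

/-- Composition with a turn. -/
def turn (b : Bool) (M : Moebius) : Moebius :=
  match b with
  | false => ⟨M.c, M.c + M.d, M.u, M.u + M.v⟩
  | true => ⟨M.c + M.d, M.d, M.u + M.v, M.v⟩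

/-- Composition with a turn and the reflection `y ↦ 1 - y`. -/
def twist (b : Bool) (M : Moebius) : Moebius :=
  match b with
  | false => ⟨M.c + M.d, M.c, M.u + M.v, M.u⟩
  | true => ⟨M.d, M.c + M.d, M.v, M.u + M.v⟩

/-- The identity transformation. -/
def start : Moebius := ⟨0, 1, 1, 1⟩

/-- The composition of a transformation with the first `n` steps along a path. -/
def run (f : Bool → Moebius → Moebius) (M : Moebius) (s : ℕ → Bool) : ℕ → Moebius
  | 0 => M
  | n + 1 => f (s n) (run f M s n)

lemma run_succ_left (f : Bool → Moebius → Moebius) (M : Moebius) (s : ℕ → Bool) (n : ℕ) :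
    run f M s (n + 1) = run f (f (s 0) M) (shift 1 s) n := by
  induction n with
  | zero => rfl
  | succ n ih =>
    rw [run, ih]
    simp [run, shift, add_comm]

lemma run_congr (f : Bool → Moebius → Moebius) (M : Moebius) {s t : ℕ → Bool} {n : ℕ}
    (h : ∀ i < n, s i = t i) : run f M s n = run f M t n := by
  induction n with
  | zero => rfl
  | succ n ih => rw [run, run, ih fun i hi => h i (hi.trans n.lt_succ_self), h n n.lt_succ_self]

/-- Transformations without pole on `[0, 1]`. -/
def Pos (M : Moebius) : Prop := 0 < M.u ∧ 0 < M.v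

lemma pos_start : start.Pos := ⟨one_pos, one_pos⟩

lemma det_start : start.det = 1 := by simp [det, start]

lemma Pos.turn {M : Moebius} (h : M.Pos) (b : Bool) : (M.turn b).Pos := by
  obtain ⟨h1, h2⟩ := h
  cases b <;> constructor <;> simp only [Moebius.turn] <;> positivity

lemma Pos.twist {M : Moebius} (h : M.Pos) (b : Bool) : (M.twist b).Pos := by
  obtain ⟨h1, h2⟩ := h
  cases b <;> constructor <;> simp only [Moebius.twist] <;> positivity

lemma det_turn (M : Moebius) (b : Bool) : (M.turn b).det = M.det := by
  cases b <;> simp only [Moebius.turn, det] <;> ring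

lemma det_twist (M : Moebius) (b : Bool) : (M.twist b).det = -M.det := by
  cases b <;> simp only [Moebius.twist, det] <;> ring

lemma Pos.run_turn {M : Moebius} (h : M.Pos) (s : ℕ → Bool) (n : ℕ) :
    (run Moebius.turn M s n).Pos := by
  induction n with
  | zero => exact h
  | succ n ih => exact ih.turn _

lemma Pos.run_twist {M : Moebius} (h : M.Pos) (s : ℕ → Bool) (n : ℕ) :
    (run Moebius.twist M s n).Pos := by
  induction n with
  | zero => exact h
  | succ n ih => exact ih.twist _

lemma det_run_turn (M : Moebius) (s : ℕ → Bool) (n : ℕ) : (run turn M s n).det = M.det := by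
  induction n with
  | zero => rfl
  | succ n ih => rw [run, det_turn, ih]

lemma abs_det_run_twist (M : Moebius) (s : ℕ → Bool) (n : ℕ) :
    |(run twist M s n).det| = |M.det| := by
  induction n with
  | zero => rfl
  | succ n ih => rw [run, det_twist, abs_neg, ih]

lemma Pos.denom_pos {M : Moebius} (h : M.Pos) {y : ℝ} (hy : y ∈ Set.Icc (0 : ℝ) 1) :
    0 < M.u * (1 - y) + M.v * y := by
  obtain ⟨h1, h2⟩ := h
  obtain ⟨hy0, hy1⟩ := hy
  rcases hy0.eq_or_lt with rfl | h3
  · simpa using h1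
  · have := mul_pos h2 h3
    have := mul_nonneg h1.le (sub_nonneg.2 hy1)
    linarith

lemma eval_start (y : ℝ) : start.eval y = y := by simp [eval, start]

lemma eval_turn (M : Moebius) (b : Bool) {y : ℝ} (hy : y ∈ Set.Icc (0 : ℝ) 1) :
    (M.turn b).eval y = M.eval (turnChi b y) := by
  obtain ⟨hy0, hy1⟩ := hy
  cases b
  · have : 1 + y ≠ 0 := by positivity
    have e : 1 - y / (1 + y) = 1 / (1 + y) := by field_simp; ring
    simp only [Moebius.turn, turnChi, eval, e]
    rw [← mul_div_mul_right _ _ (inv_ne_zero this)]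
    congr 1 <;> field_simp <;> ring
  · have : 2 - y ≠ 0 := by linarith
    have e : 1 - 1 / (2 - y) = (1 - y) / (2 - y) := by field_simp; ring
    simp only [Moebius.turn, turnChi, eval, e]
    rw [← mul_div_mul_right _ _ (inv_ne_zero this)]
    congr 1 <;> field_simp <;> ring

lemma eval_twist (M : Moebius) (b : Bool) {y : ℝ}
    (hy : y ∈ Set.Icc (0 : ℝ) 1) : (M.twist b).eval y = M.eval (turnChi b (1 - y)) := by
  rw [← M.eval_turn b ⟨by linarith [hy.2], by linarith [hy.1]⟩]
  cases b <;> simp only [Moebius.twist, Moebius.turn, eval] <;> congr 1 <;> ring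

lemma Pos.eval_sub_eval {M : Moebius} (h : M.Pos) {y z : ℝ} (hy : y ∈ Set.Icc (0 : ℝ) 1)
    (hz : z ∈ Set.Icc (0 : ℝ) 1) : M.eval y - M.eval z =
      M.det * (y - z) / ((M.u * (1 - y) + M.v * y) * (M.u * (1 - z) + M.v * z)) := by
  rw [eval, eval, div_sub_div _ _ (h.denom_pos hy).ne' (h.denom_pos hz).ne', det]
  congr 1
  ring

/-- With determinant ±1, the image of [0, 1] is an interval of length 1/(uv). -/
lemma Pos.abs_eval_sub_le {M : Moebius} (h : M.Pos) (hd : |M.det| = 1) {y z : ℝ}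
    (hy : y ∈ Set.Icc (0 : ℝ) 1) (hz : z ∈ Set.Icc (0 : ℝ) 1) :
    |M.eval y - M.eval z| ≤ 1 / (M.u * M.v) := by
  wlog hyz : z ≤ y generalizing y z
  · rw [abs_sub_comm]; exact this hz hy (not_le.1 hyz).le
  have h1 := h.denom_pos hy
  have h2 := h.denom_pos hz
  obtain ⟨hu, hv⟩ := h
  rw [Pos.eval_sub_eval ⟨hu, hv⟩ hy hz, abs_div, abs_mul, hd, one_mul, abs_of_pos (mul_pos h1 h2),
    abs_of_nonneg (sub_nonneg.2 hyz), div_le_div_iff₀ (mul_pos h1 h2) (mul_pos hu hv)]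
  have e : 1 * ((M.u * (1 - y) + M.v * y) * (M.u * (1 - z) + M.v * z)) - (y - z) * (M.u * M.v) =
      M.u ^ 2 * ((1 - y) * (1 - z)) + M.v ^ 2 * (y * z) + 2 * (M.u * M.v) * (z * (1 - y)) := by
    ring
  have hy' := sub_nonneg.2 hy.2
  have hz' := sub_nonneg.2 hz.2
  have hy0 := hy.1
  have hz0 := hz.1
  have : 0 ≤ M.u ^ 2 * ((1 - y) * (1 - z)) + M.v ^ 2 * (y * z) +
      2 * (M.u * M.v) * (z * (1 - y)) := by positivity
  linarith

lemma Pos.eval_mono {M : Moebius} (h : M.Pos) (hd : M.det = 1) {y z : ℝ}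
    (hy : y ∈ Set.Icc (0 : ℝ) 1) (hz : z ∈ Set.Icc (0 : ℝ) 1) (hyz : y ≤ z) :
    M.eval y ≤ M.eval z := by
  rw [← sub_nonneg, h.eval_sub_eval hz hy, hd, one_mul]
  exact div_nonneg (sub_nonneg.2 hyz) (mul_pos (h.denom_pos hz) (h.denom_pos hy)).le

end Moebius

open Moebius

/-! ### Functional equations for the point of a path and its jimm image -/

lemma chiPath_mem (s : ℕ → Bool) : chiPath s ∈ Set.Icc (0 : ℝ) 1 :=
  ⟨chiPath_nonneg s, chiPath_le_one s⟩

lemma chiTwist_mem (s : ℕ → Bool) : chiTwist s ∈ Set.Icc (0 : ℝ) 1 :=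
  ⟨chiTwist_nonneg s, chiTwist_le_one s⟩

/-- A function of paths that is compatible with turns is determined along the path. -/
lemma eval_run_turn {F : (ℕ → Bool) → ℝ} (h01 : ∀ s, F s ∈ Set.Icc (0 : ℝ) 1)
    (hF : ∀ s, F s = turnChi (s 0) (F (shift 1 s))) (M : Moebius) (s : ℕ → Bool)
    (n : ℕ) : (run turn M s n).eval (F (shift n s)) = M.eval (F s) := by
  induction n with
  | zero => rw [shift_zero]; rfl
  | succ n ih =>
    rw [run, eval_turn _ _ (h01 _), ← ih, hF (shift n s), shift_shift]
    rfl

lemma add_one_le_run_turn (s : ℕ → Bool) (n : ℕ) : 1 ≤ (run turn start s n).u ∧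
    1 ≤ (run turn start s n).v ∧ (n : ℝ) + 1 ≤ (run turn start s n).u * (run turn start s n).v := by
  induction n with
  | zero => simp [run, start]
  | succ n ih =>
    obtain ⟨h1, h2, h3⟩ := ih
    rw [run]
    cases s n <;> simp only [turn] <;> push_cast <;> refine ⟨?_, ?_, ?_⟩ <;> nlinarith

/-- Uniqueness: F s and `chiPath s` lie in the same n-th Farey interval, whose length 1/(uv) is at
most 1/(n + 1) because every turn adds u² or v² to uv. -/
lemma eq_chiPath {F : (ℕ → Bool) → ℝ} (h01 : ∀ s, F s ∈ Set.Icc (0 : ℝ) 1)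
    (hF : ∀ s, F s = turnChi (s 0) (F (shift 1 s))) (s : ℕ → Bool) : F s = chiPath s := by
  have key : ∀ n : ℕ, |F s - chiPath s| ≤ 1 / ((n : ℝ) + 1) := by
    intro n
    have h1 := eval_run_turn h01 hF start s n
    have h2 := eval_run_turn chiPath_mem chiPath_eq start s n
    rw [eval_start] at h1 h2
    rw [← h1, ← h2]
    refine ((pos_start.run_turn s n).abs_eval_sub_le (by simp [det_run_turn, det_start])
      (h01 _) (chiPath_mem _)).trans ?_
    exact one_div_le_one_div_of_le (by positivity) (add_one_le_run_turn s n).2.2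
  have := ge_of_tendsto' tendsto_one_div_add_atTop_nhds_zero_nat key
  rw [← sub_eq_zero]
  exact abs_nonpos_iff.1 this

lemma chiPath_not (s : ℕ → Bool) : chiPath (fun i => !s i) = 1 - chiPath s := by
  have := eq_chiPath (F := fun s => 1 - chiPath fun i => !s i)
    (fun s => ⟨sub_nonneg.2 (chiPath_le_one _), sub_le_self _ (chiPath_nonneg _)⟩) (fun s => by
      have h0 := chiPath_nonneg fun i => !(shift 1 s) i
      have h1 := chiPath_le_one fun i => !(shift 1 s) i
      change 1 - chiPath (fun i => !s i) = turnChi (s 0) (1 - chiPath fun i => !(shift 1 s) i)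
      rw [chiPath_eq]
      change 1 - turnChi (!s 0) (chiPath fun i => !(shift 1 s) i) = _
      generalize chiPath (fun i => !(shift 1 s) i) = y at *
      have h2 : 2 - y ≠ 0 := by linarith
      have h3 : 1 + y ≠ 0 := by linarith
      have h4 : 1 + (1 - y) ≠ 0 := by linarith
      have h5 : 2 - (1 - y) ≠ 0 := by linarith
      cases s 0 <;> simp only [turnChi, Bool.not_true, Bool.not_false]
      · field_simp
        ring
      · field_simp
        ring) s
  linarith

/-- Shifting the alternating mask by one place negates it, and negating all turns is y ↦ 1 - y.
Hence jimm is a turn combined with a reflection at every step, which is what `Moebius.twist`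
encodes. -/
lemma chiTwist_eq (s : ℕ → Bool) : chiTwist s = turnChi (s 0) (1 - chiTwist (shift 1 s)) := by
  rw [chiTwist, chiPath_eq, chiTwist, ← chiPath_not]
  congr 1
  · simp
  · congr 1
    funext i
    simp [shift, add_comm 1 i, Nat.bodd_succ]

lemma eval_run_twist (M : Moebius) (s : ℕ → Bool) (n : ℕ) :
    (run twist M s n).eval (chiTwist (shift n s)) = M.eval (chiTwist s) := by
  induction n with
  | zero => rw [shift_zero]; rfl
  | succ n ih =>
    rw [run, eval_twist _ _ (chiTwist_mem _), ← ih, chiTwist_eq (shift n s),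
      shift_shift]
    rfl

lemma turnChi_false_le {y : ℝ} (hy : y ∈ Set.Icc (0 : ℝ) 1) : turnChi false y ≤ 1 / 2 := by
  obtain ⟨h0, h1⟩ := hy
  simp only [turnChi]
  rw [div_le_div_iff₀ (by positivity) (by norm_num)]
  linarith

lemma le_turnChi_true {y : ℝ} (hy : y ∈ Set.Icc (0 : ℝ) 1) : 1 / 2 ≤ turnChi true y := by
  obtain ⟨h0, h1⟩ := hy
  simp only [turnChi]
  rw [div_le_div_iff₀ (by norm_num) (by linarith)]
  linarith

/-! ### Separation of paths and the flatness criterion -/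

/-- The point at which the paths that follow `s` for `n` turns separate. -/
noncomputable def midpoint (s : ℕ → Bool) (n : ℕ) : ℝ := (run turn start s n).eval (1 / 2)

/-- The length of the interval of jimm values for paths that follow `s` for `n` turns. -/
noncomputable def twistLength (s : ℕ → Bool) (n : ℕ) : ℝ :=
  1 / ((run twist start s n).u * (run twist start s n).v)

lemma twistLength_pos (s : ℕ → Bool) (n : ℕ) : 0 < twistLength s n := by
  obtain ⟨h1, h2⟩ := pos_start.run_twist s n
  unfold twistLength
  positivity

lemma abs_chiTwist_sub_le {s t : ℕ → Bool} {n : ℕ} (h : ∀ i < n, s i = t i) :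
    |chiTwist t - chiTwist s| ≤ twistLength s n := by
  have h1 := eval_run_twist start s n
  have h2 := eval_run_twist start t n
  rw [eval_start] at h1 h2
  rw [← run_congr twist start h] at h2
  rw [← h1, ← h2]
  exact (pos_start.run_twist s n).abs_eval_sub_le
    (by simp [abs_det_run_twist, det_start]) (chiTwist_mem _) (chiTwist_mem _)

/-- One of the two paths turns left and the other right at step n, so the mediant of their common
interval lies between their points. -/
lemma abs_chiPath_sub_midpoint_le {s t : ℕ → Bool} {n : ℕ} (h : ∀ i < n, s i = t i)
    (hn : s n ≠ t n) : |chiPath s - midpoint s n| ≤ |chiPath t - chiPath s| := by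
  have h1 := eval_run_turn chiPath_mem chiPath_eq start s n
  have h2 := eval_run_turn chiPath_mem chiPath_eq start t n
  rw [eval_start] at h1 h2
  rw [← run_congr turn start h] at h2
  have hpos := pos_start.run_turn s n
  have hdet : (run turn start s n).det = 1 := by rw [det_run_turn, det_start]
  have half : (1 / 2 : ℝ) ∈ Set.Icc (0 : ℝ) 1 := by norm_num
  have key : ∀ r : ℕ → Bool, r n = false → chiPath (shift n r) ≤ 1 / 2 := by
    intro r hr
    have e : shift n r 0 = false := by simpa [shift] using hr
    rw [chiPath_eq, e]
    exact turnChi_false_le (chiPath_mem _)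
  have key' : ∀ r : ℕ → Bool, r n = true → 1 / 2 ≤ chiPath (shift n r) := by
    intro r hr
    have e : shift n r 0 = true := by simpa [shift] using hr
    rw [chiPath_eq, e]
    exact le_turnChi_true (chiPath_mem _)
  rw [midpoint, ← h1, ← h2]
  cases hs : s n
  · have ht : t n = true := by
      cases ht : t n
      · exact absurd (hs.trans ht.symm) hn
      · rfl
    have e1 := hpos.eval_mono hdet (chiPath_mem _) half (key s hs)
    have e2 := hpos.eval_mono hdet half (chiPath_mem _) (key' t ht)
    rw [abs_of_nonpos (by linarith), abs_of_nonneg (by linarith)]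
    linarith
  · have ht : t n = false := by
      cases ht : t n
      · rfl
      · exact absurd (hs.trans ht.symm) hn
    have e1 := hpos.eval_mono hdet half (chiPath_mem _) (key' s hs)
    have e2 := hpos.eval_mono hdet (chiPath_mem _) half (key t ht)
    rw [abs_of_nonneg (by linarith), abs_of_nonpos (by linarith)]
    linarith

/-- Paths along which the intervals of jimm values are negligible with respect to the distance to
the points where other paths separate. -/
def Flat (s : ℕ → Bool) : Prop :=
  (∀ n, chiPath s ≠ midpoint s n) ∧
    ∀ K : ℕ, ∀ᶠ n in atTop, (K : ℝ) * twistLength s n < |chiPath s - midpoint s n|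

lemma Flat.exists_dist_le {s : ℕ → Bool} (hs : Flat s) {ε : ℝ} (hε : 0 < ε) :
    ∃ δ > 0, ∀ t : ℕ → Bool, |chiPath t - chiPath s| < δ →
      |chiTwist t - chiTwist s| ≤ ε * |chiPath t - chiPath s| := by
  obtain ⟨K, hK⟩ := exists_nat_gt (1 / ε)
  obtain ⟨N, hN⟩ := eventually_atTop.1 (hs.2 K)
  -- A path whose point is closer than this δ cannot separate from s before step N, where the bound
  -- `hN` starts.
  have hδ : ∃ δ > 0, ∀ n < N, δ ≤ |chiPath s - midpoint s n| := by
    clear hN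
    induction N with
    | zero => exact ⟨1, one_pos, by simp⟩
    | succ N ih =>
      obtain ⟨δ, h0, h⟩ := ih
      refine ⟨min δ |chiPath s - midpoint s N|,
        lt_min h0 (abs_pos.2 (sub_ne_zero.2 (hs.1 N))), fun n hn => ?_⟩
      rcases (Nat.lt_succ_iff_lt_or_eq.1 hn) with h' | rfl
      · exact (min_le_left _ _).trans (h n h')
      · exact min_le_right _ _
  obtain ⟨δ, h0, h⟩ := hδ
  refine ⟨δ, h0, fun t ht => ?_⟩
  by_cases hst : s = t
  · simp [hst]
  have hex : ∃ n, s n ≠ t n := by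
    by_contra hc
    push Not at hc
    exact hst (funext hc)
  classical
  have hlt : ∀ i < Nat.find hex, s i = t i := fun i hi => not_not.1 (Nat.find_min hex hi)
  have hm := abs_chiPath_sub_midpoint_le hlt (Nat.find_spec hex)
  have hl := abs_chiTwist_sub_le hlt
  have hge : N ≤ Nat.find hex := by
    by_contra hc
    linarith [h _ (not_le.1 hc)]
  have hk := hN _ hge
  have hp := twistLength_pos s (Nat.find hex)
  have : 1 ≤ ε * K := by
    rw [div_lt_iff₀ hε] at hK
    linarith
  nlinarith

/-! ### Geometric decay of the Hellinger affinity -/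

/-- The sum, over the words of `n` turns, of the geometric means of the lengths of an interval and
of its image under jimm, starting from intervals of length `1 / (u * v)` and `1 / (p * q)`. -/
noncomputable def affinity : ℕ → ℝ → ℝ → ℝ → ℝ → ℝ
  | 0, u, v, p, q => √((u * v * (p * q))⁻¹)
  | n + 1, u, v, p, q => affinity n u (u + v) (p + q) p + affinity n (u + v) v q (p + q)

lemma affinity_nonneg (n : ℕ) : ∀ u v p q : ℝ, 0 ≤ affinity n u v p q := by
  induction n with
  | zero => intros; exact Real.sqrt_nonneg _
  | succ n ih => intros; exact add_nonneg (ih _ _ _ _) (ih _ _ _ _)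

/-- The factor by which two turns change the affinity, where `r` and `s` are the probabilities of
a right turn. -/
noncomputable def affinityFactor (r s : ℝ) : ℝ :=
  √((1 - r) / (1 + r) * ((1 - s) * s / (1 + s))) + √((1 - r) * r / (1 + r) * ((1 - s) / (1 + s))) +
    (√(r * (1 - r) / (2 - r) * (s / (2 - s))) + √(r / (2 - r) * (s * (1 - s) / (2 - s))))

lemma sqrt_mul_le_half_add {x y : ℝ} (hx : 0 ≤ x) (hy : 0 ≤ y) : √(x * y) ≤ (x + y) / 2 := by
  rw [Real.sqrt_le_left (by positivity)]
  nlinarith [sq_nonneg (x - y)]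

lemma eq_of_half_add_le_sqrt {x y : ℝ} (hx : 0 ≤ x) (hy : 0 ≤ y) (h : (x + y) / 2 ≤ √(x * y)) :
    x = y := by
  rw [Real.le_sqrt (by positivity) (by positivity)] at h
  have : (x - y) ^ 2 ≤ 0 := by nlinarith
  exact sub_eq_zero.1 (pow_eq_zero_iff two_ne_zero |>.1 (le_antisymm this (sq_nonneg _)))

/-- The factor is the affinity of two distributions on the four words of two turns, so AM-GM bounds
it by 1, with equality only if they coincide. Coincidence forces s = 1, and then r = 1 from one word
and r = 0 from another. A single turn would not do: its distributions (1 - r, r) and (1 - s, s)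
agree when r = s. -/
lemma affinityFactor_lt_one {r s : ℝ} (hr : r ∈ Set.Icc (0 : ℝ) 1) (hs : s ∈ Set.Icc (0 : ℝ) 1) :
    affinityFactor r s < 1 := by
  obtain ⟨hr0, hr1⟩ := hr
  obtain ⟨hs0, hs1⟩ := hs
  have hr' := sub_nonneg.2 hr1
  have hs' := sub_nonneg.2 hs1
  have hr2 : 0 < 2 - r := by linarith
  have hs2 : 0 < 2 - s := by linarith
  by_contra hc
  push Not at hc
  unfold affinityFactor at hc
  have x1 : 0 ≤ (1 - r) / (1 + r) := by positivity
  have y1 : 0 ≤ (1 - s) * s / (1 + s) := by positivity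
  have x2 : 0 ≤ (1 - r) * r / (1 + r) := by positivity
  have y2 : 0 ≤ (1 - s) / (1 + s) := by positivity
  have x3 : 0 ≤ r * (1 - r) / (2 - r) := by positivity
  have y3 : 0 ≤ s / (2 - s) := by positivity
  have x4 : 0 ≤ r / (2 - r) := by positivity
  have y4 : 0 ≤ s * (1 - s) / (2 - s) := by positivity
  have sr : (1 - r) / (1 + r) + (1 - r) * r / (1 + r) + r * (1 - r) / (2 - r) + r / (2 - r) = 1 := by
    field_simp
    ring
  have ss : (1 - s) * s / (1 + s) + (1 - s) / (1 + s) + s / (2 - s) + s * (1 - s) / (2 - s) = 1 := by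
    field_simp
    ring
  have h1 := sqrt_mul_le_half_add x1 y1
  have h2 := sqrt_mul_le_half_add x2 y2
  have h3 := sqrt_mul_le_half_add x3 y3
  have h4 := sqrt_mul_le_half_add x4 y4
  have e1 := eq_of_half_add_le_sqrt x1 y1 (by linarith)
  have e2 := eq_of_half_add_le_sqrt x2 y2 (by linarith)
  have e4 := eq_of_half_add_le_sqrt x4 y4 (by linarith)
  clear h1 h2 h3 h4 x1 x2 x3 x4 y1 y2 y3 y4 sr ss hc
  rw [div_eq_div_iff (by positivity) (by positivity)] at e1 e2 e4
  have h5 : (1 - s) * (1 - r * s) = 0 := by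
    have : (1 + r) * ((1 - s) * (1 - r * s)) = 0 := by linear_combination r * e1 - e2
    exact (mul_eq_zero.1 this).resolve_left (by positivity)
  have h6 : s = 1 := by
    rcases mul_eq_zero.1 h5 with h | h
    · linarith
    · nlinarith
  subst h6
  nlinarith

lemma continuousOn_affinityFactor : ContinuousOn (fun x : ℝ × ℝ => affinityFactor x.1 x.2)
    (Set.Icc (0 : ℝ) 1 ×ˢ Set.Icc (0 : ℝ) 1) := by
  unfold affinityFactor
  have h : ∀ x ∈ Set.Icc (0 : ℝ) 1 ×ˢ Set.Icc (0 : ℝ) 1, (1 + x.1 ≠ 0 ∧ 1 + x.2 ≠ 0) ∧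
      (2 - x.1 ≠ 0 ∧ 2 - x.2 ≠ 0) := by
    rintro ⟨x, y⟩ ⟨⟨h1, h2⟩, ⟨h3, h4⟩⟩
    simp only at *
    refine ⟨⟨?_, ?_⟩, ⟨?_, ?_⟩⟩ <;> intro h <;> linarith
  have d1 := fun x hx => (h x hx).1.1
  have d2 := fun x hx => (h x hx).1.2
  have d3 := fun x hx => (h x hx).2.1
  have d4 := fun x hx => (h x hx).2.2
  have hm := fun x hx => mul_ne_zero (d1 x hx) (d2 x hx)
  fun_prop (disch := assumption)

lemma exists_affinityFactor_le : ∃ θ : ℝ, 0 ≤ θ ∧ θ < 1 ∧ ∀ r ∈ Set.Icc (0 : ℝ) 1,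
    ∀ s ∈ Set.Icc (0 : ℝ) 1, affinityFactor r s ≤ θ := by
  obtain ⟨x, hx, hmax⟩ := (isCompact_Icc.prod isCompact_Icc).exists_isMaxOn
    ⟨((0 : ℝ), (0 : ℝ)), by simp⟩ continuousOn_affinityFactor
  refine ⟨affinityFactor x.1 x.2, ?_, affinityFactor_lt_one hx.1 hx.2,
    fun r hr s hs => hmax (Set.mk_mem_prod hr hs)⟩
  unfold affinityFactor
  positivity

lemma affinity_two (u v p q : ℝ) (hu : 0 < u) (hv : 0 < v) (hp : 0 < p) (hq : 0 < q) :
    affinity 2 u v p q = affinityFactor (u / (u + v)) (p / (p + q)) * affinity 0 u v p q := by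
  simp only [affinity, affinityFactor, add_mul, ← Real.sqrt_mul' _
    (inv_nonneg.2 (mul_pos (mul_pos hu hv) (mul_pos hp hq)).le)]
  have e1 : 1 - u / (u + v) = v / (u + v) := by field_simp; ring
  have e2 : 1 + u / (u + v) = (2 * u + v) / (u + v) := by field_simp; ring
  have e3 : 2 - u / (u + v) = (u + 2 * v) / (u + v) := by field_simp; ring
  have e4 : 1 - p / (p + q) = q / (p + q) := by field_simp; ring
  have e5 : 1 + p / (p + q) = (2 * p + q) / (p + q) := by field_simp; ring
  have e6 : 2 - p / (p + q) = (p + 2 * q) / (p + q) := by field_simp; ring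
  rw [e1, e2, e3, e4, e5, e6]
  congr 2 <;> congr 1
  · field_simp; ring
  · field_simp; ring
  · field_simp; ring
  · field_simp; ring

/-- The recursion peels off the first turn, so the induction reduces to refining each word by two
final turns, where `affinity_two` applies. -/
lemma affinity_add_two_le {θ : ℝ} (hθ : ∀ r ∈ Set.Icc (0 : ℝ) 1, ∀ s ∈ Set.Icc (0 : ℝ) 1,
    affinityFactor r s ≤ θ) (n : ℕ) : ∀ u v p q : ℝ, 0 < u → 0 < v → 0 < p → 0 < q →
    affinity (n + 2) u v p q ≤ θ * affinity n u v p q := by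
  induction n with
  | zero =>
    intro u v p q hu hv hp hq
    rw [zero_add, affinity_two u v p q hu hv hp hq]
    refine mul_le_mul_of_nonneg_right (hθ _ ⟨by positivity, ?_⟩ _ ⟨by positivity, ?_⟩)
      (affinity_nonneg _ _ _ _ _)
    · exact (div_le_one (by positivity)).2 (by linarith)
    · exact (div_le_one (by positivity)).2 (by linarith)
  | succ n ih =>
    intro u v p q hu hv hp hq
    change affinity (n + 2) _ _ _ _ + affinity (n + 2) _ _ _ _ ≤
      θ * (affinity n _ _ _ _ + affinity n _ _ _ _)
    rw [mul_add]
    exact add_le_add (ih _ _ _ _ hu (by positivity) (by positivity) hp)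
      (ih _ _ _ _ (by positivity) hv hq (by positivity))

lemma summable_affinity : Summable fun n => affinity n 1 1 1 1 := by
  obtain ⟨θ, h0, h1, hθ⟩ := exists_affinityFactor_le
  have step := fun n => affinity_add_two_le hθ n 1 1 1 1 one_pos one_pos one_pos one_pos
  have aux : ∀ j k, affinity (j + 2 * k) 1 1 1 1 ≤ affinity j 1 1 1 1 * θ ^ k := by
    intro j k
    induction k with
    | zero => simp
    | succ k ih =>
      have := step (j + 2 * k)
      calc affinity (j + 2 * (k + 1)) 1 1 1 1 ≤ θ * affinity (j + 2 * k) 1 1 1 1 := this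
        _ ≤ θ * (affinity j 1 1 1 1 * θ ^ k) := mul_le_mul_of_nonneg_left ih h0
        _ = _ := by ring
  have hs : ∀ j, Summable fun k => affinity (j + 2 * k) 1 1 1 1 := fun j =>
    Summable.of_nonneg_of_le (fun k => affinity_nonneg _ _ _ _ _) (aux j)
      ((summable_geometric_of_lt_one h0 h1).mul_left _)
  refine Summable.even_add_odd ?_ ?_
  · simpa using hs 0
  · simpa [add_comm] using hs 1

/-! ### Borel–Cantelli: almost every point is flat -/

/-- The points near a midpoint of the `n`-th generation, as measured by the length of the interval
of jimm values. -/
def badSet (K : ℝ) (n : ℕ) (M M' : Moebius) : Set ℝ :=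
  {y | ∃ s : ℕ → Bool, M.eval (chiPath s) = y ∧ |y - (run turn M s n).eval (1 / 2)| ≤
    K * (1 / ((run twist M' s n).u * (run twist M' s n).v))}

/-- The set lies both in the interval of length A and in a ball of diameter B, a multiple of the
image length, so its measure is at most min(A, B) ≤ √(AB). This is how the affinity enters. -/
lemma volume_badSet_zero_le {K : ℝ} (hK : 0 ≤ K) {M M' : Moebius} (h : M.Pos) (hd : M.det = 1)
    (h' : M'.Pos) :
    volume (badSet K 0 M M') ≤ ENNReal.ofReal (√(2 * K) * affinity 0 M.u M.v M'.u M'.v) := by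
  set A := 1 / (M.u * M.v) with hA
  set B := 2 * K * (1 / (M'.u * M'.v)) with hB
  have hA0 : 0 ≤ A := by have := h.1; have := h.2; positivity
  have hB0 : 0 ≤ B := by have := h'.1; have := h'.2; positivity
  have h1 : volume (badSet K 0 M M') ≤ ENNReal.ofReal A := by
    have : badSet K 0 M M' ⊆ Set.Icc (M.eval 0) (M.eval 0 + A) := by
      rintro y ⟨s, rfl, -⟩
      have z : (0 : ℝ) ∈ Set.Icc (0 : ℝ) 1 := by norm_num
      refine ⟨h.eval_mono hd z (chiPath_mem _) (chiPath_nonneg s), ?_⟩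
      have := (abs_le.1 (h.abs_eval_sub_le (by simp [hd]) (chiPath_mem s) z)).2
      linarith
    refine (measure_mono this).trans ?_
    simp
  have h2 : volume (badSet K 0 M M') ≤ ENNReal.ofReal B := by
    have : badSet K 0 M M' ⊆ Metric.closedBall (M.eval (1 / 2)) (K * (1 / (M'.u * M'.v))) := by
      rintro y ⟨s, -, hy⟩
      exact hy
    refine (measure_mono this).trans ?_
    rw [Real.volume_closedBall, hB, mul_assoc]
  refine (le_min h1 h2).trans ?_
  rw [← ENNReal.ofReal_min]
  refine ENNReal.ofReal_le_ofReal ?_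
  rw [affinity, ← Real.sqrt_mul (by positivity)]
  refine Real.le_sqrt_of_sq_le ?_
  have e : 2 * K * (M.u * M.v * (M'.u * M'.v))⁻¹ = A * B := by
    rw [hA, hB, mul_inv]; ring
  rw [e, sq]
  exact mul_le_mul (min_le_left _ _) (min_le_right _ _) (le_min hA0 hB0) hA0

lemma volume_badSet_le {K : ℝ} (hK : 0 ≤ K) (n : ℕ) : ∀ {M M' : Moebius}, M.Pos → M.det = 1 →
    M'.Pos →
    volume (badSet K n M M') ≤ ENNReal.ofReal (√(2 * K) * affinity n M.u M.v M'.u M'.v) := by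
  induction n with
  | zero => exact volume_badSet_zero_le hK
  | succ n ih =>
    intro M M' h hd h'
    have hsub : badSet K (n + 1) M M' ⊆ badSet K n (M.turn false) (M'.twist false) ∪
        badSet K n (M.turn true) (M'.twist true) := by
      rintro y ⟨s, hy, hs⟩
      rw [run_succ_left, run_succ_left] at hs
      rw [chiPath_eq, ← M.eval_turn _ (chiPath_mem _)] at hy
      cases hb : s 0
      · rw [hb] at hs hy
        exact Or.inl ⟨shift 1 s, hy, hs⟩
      · rw [hb] at hs hy
        exact Or.inr ⟨shift 1 s, hy, hs⟩
    refine (measure_mono hsub).trans ((measure_union_le _ _).trans ?_)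
    rw [affinity, mul_add, ENNReal.ofReal_add
      (mul_nonneg (Real.sqrt_nonneg _) (affinity_nonneg _ _ _ _ _))
      (mul_nonneg (Real.sqrt_nonneg _) (affinity_nonneg _ _ _ _ _))]
    refine add_le_add ((ih (h.turn _) (by rw [det_turn, hd]) (h'.twist _)).trans_eq ?_)
      ((ih (h.turn _) (by rw [det_turn, hd]) (h'.twist _)).trans_eq ?_) <;>
    simp only [turn, twist]

lemma ae_flat : ∀ᵐ y : ℝ, ∀ s, chiPath s = y → Flat s := by
  have hbad : ∀ (K : ℝ) (n : ℕ), 0 ≤ K → volume (badSet K n start start) ≤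
      ENNReal.ofReal (√(2 * K) * affinity n 1 1 1 1) := fun K n hK => by
    simpa [start] using volume_badSet_le hK n pos_start det_start pos_start
  -- The case K = 0 has measure bound zero; it removes the points that are themselves mediants.
  have h0 : ∀ᵐ y : ℝ, ∀ n, y ∉ badSet 0 n start start := by
    rw [ae_all_iff]
    intro n
    refine measure_eq_zero_iff_ae_notMem.1 ?_
    simpa using hbad 0 n le_rfl
  have h1 : ∀ᵐ y : ℝ, ∀ K : ℕ, ∀ᶠ n in atTop, y ∉ badSet K n start start := by
    rw [ae_all_iff]
    intro K
    refine ae_eventually_notMem (ne_top_of_le_ne_top ?_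
      (ENNReal.tsum_le_tsum fun n => hbad K n K.cast_nonneg))
    exact (summable_affinity.mul_left _).tsum_ofReal_ne_top
  filter_upwards [h0, h1] with y hy0 hy1 s hs
  refine ⟨fun n hn => hy0 n ⟨s, by rw [eval_start, hs], ?_⟩, fun K => ?_⟩
  · rw [← hs, hn, midpoint, sub_self, abs_zero, zero_mul]
  · filter_upwards [hy1 K] with n hn
    by_contra hc
    refine hn ⟨s, by rw [eval_start, hs], ?_⟩
    rw [← hs]
    exact not_lt.1 hc

/-! ### Return to the projective line -/

lemma toRHat_of_chi_ne_zero {v : ENNReal} (h : chi v ≠ 0) :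
    toRHat v = ((1 / chi v - 1 : ℝ) : RHat) := by
  have hv : v ≠ ⊤ := by
    rintro rfl
    exact h chi_top
  have e := chi_ofReal (x := v.toReal) ENNReal.toReal_nonneg
  rw [ENNReal.ofReal_toReal hv] at e
  rw [toRHat, if_neg hv, e]
  simp

lemma chi_of_toRHat_eq {v : ENNReal} {x : ℝ} (h : toRHat v = (x : RHat)) :
    0 ≤ x ∧ chi v = 1 / (1 + x) := by
  have hv : v ≠ ⊤ := by
    rintro rfl
    simp [toRHat] at h
  rw [toRHat, if_neg hv, OnePoint.coe_eq_coe] at h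
  have hx : 0 ≤ x := h ▸ ENNReal.toReal_nonneg
  refine ⟨hx, ?_⟩
  rw [← chi_ofReal hx, ← h, ENNReal.ofReal_toReal hv]

lemma chiPath_of_cfm_false {s : ℕ → Bool} {x : ℝ} (h : cfm ⟨false, s⟩ = (x : RHat)) :
    0 ≤ x ∧ chiPath s = 1 / (1 + x) :=
  chi_of_toRHat_eq h

lemma chiPath_of_cfm_true {s : ℕ → Bool} {x : ℝ} (h : cfm ⟨true, s⟩ = (x : RHat)) :
    x ≤ 0 ∧ chiPath s = 1 - 1 / (1 - x) := by
  have h' : toRHat (turnValue s)⁻¹ = ((-x : ℝ) : RHat) := by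
    change (toRHat (turnValue s)⁻¹).map (fun x : ℝ => -x) = (x : RHat) at h
    generalize toRHat (turnValue s)⁻¹ = w at h
    induction w using OnePoint.rec with
    | infty => simp at h
    | coe w =>
      rw [OnePoint.map_some, OnePoint.coe_eq_coe] at h
      rw [← h, neg_neg]
  obtain ⟨h0, h1⟩ := chi_of_toRHat_eq h'
  rw [chi_inv] at h1
  refine ⟨by linarith, ?_⟩
  rw [chiPath, sub_eq_add_neg 1 x, ← h1]
  ring

lemma cfm_jimmEnd_false {s : ℕ → Bool} (h : chiTwist s ≠ 0) :
    cfm (jimmEnd ⟨false, s⟩) = ((1 / chiTwist s - 1 : ℝ) : RHat) :=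
  toRHat_of_chi_ne_zero h

/-- On the negative side the mask 101010… replaces y by 1 - y, and the inversion in `cfm` undoes
this, so the same `chiTwist` serves both sides. -/
lemma cfm_jimmEnd_true {s : ℕ → Bool} (h : chiTwist s ≠ 0) :
    cfm (jimmEnd ⟨true, s⟩) = ((-(1 / chiTwist s - 1) : ℝ) : RHat) := by
  have e : chi (turnValue (jimmEnd ⟨true, s⟩).turn)⁻¹ = chiTwist s := by
    rw [chi_inv]
    change 1 - chiPath _ = _
    rw [← chiPath_not, chiTwist]
    congr 1
    funext i
    simp [jimmEnd, Nat.bodd_succ]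
  change (toRHat (turnValue (jimmEnd ⟨true, s⟩).turn)⁻¹).map (fun x : ℝ => -x) = _
  rw [toRHat_of_chi_ne_zero (by rwa [e]), e, OnePoint.map_some]

lemma IsJimm.exists_of_pos {f : RHat → RHat} (hf : IsJimm f) {x : ℝ} (hx : 0 < x) :
    ∃ s, chiPath s = 1 / (1 + x) ∧
      (chiTwist s ≠ 0 → f x = ((1 / chiTwist s - 1 : ℝ) : RHat)) := by
  obtain ⟨⟨_ | _, s⟩, h1, h2⟩ := hf x
  · exact ⟨s, (chiPath_of_cfm_false h1).2, fun h => by rw [← h2, cfm_jimmEnd_false h]⟩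
  · linarith [(chiPath_of_cfm_true h1).1]

lemma IsJimm.exists_of_neg {f : RHat → RHat} (hf : IsJimm f) {x : ℝ} (hx : x < 0) :
    ∃ s, chiPath s = 1 - 1 / (1 - x) ∧
      (chiTwist s ≠ 0 → f x = ((-(1 / chiTwist s - 1) : ℝ) : RHat)) := by
  obtain ⟨⟨_ | _, s⟩, h1, h2⟩ := hf x
  · linarith [(chiPath_of_cfm_false h1).1]
  · exact ⟨s, (chiPath_of_cfm_true h1).2, fun h => by rw [← h2, cfm_jimmEnd_true h]⟩

/-- Here Φ is the chart at the source and Ψ the inverse chart at the target. Flatness at a gives x ↦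
`chiTwist (S x)` derivative 0 for any selection S of paths, and the chain rule finishes. Since ∞
corresponds to `chiTwist` = 0, continuity keeps the values finite near a. -/
lemma hasFiniteDerivAt_of_flat {f : RHat → RHat} {a : ℝ} {Φ Ψ : ℝ → ℝ}
    (hΦ : DifferentiableAt ℝ Φ a) (hΨ : ∀ y, y ≠ 0 → DifferentiableAt ℝ Ψ y)
    (hf : ∀ᶠ x : ℝ in 𝓝 a, ∃ s, chiPath s = Φ x ∧
      (chiTwist s ≠ 0 → f (x : RHat) = ((Ψ (chiTwist s) : ℝ) : RHat)))
    (ha : ∀ s, chiPath s = Φ a → Flat s ∧ chiTwist s ≠ 0) : HasFiniteDerivAt f 0 a := by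
  have hex : ∀ x : ℝ, (∃ s, chiPath s = Φ x ∧
      (chiTwist s ≠ 0 → f (x : RHat) = ((Ψ (chiTwist s) : ℝ) : RHat))) → ∃ s, chiPath s = Φ x ∧
      (chiTwist s ≠ 0 → f (x : RHat) = ((Ψ (chiTwist s) : ℝ) : RHat)) := fun x h => h
  choose! S hS using hex
  have hSa := hS a hf.self_of_nhds
  obtain ⟨hflat, hne⟩ := ha _ hSa.1
  have hC : HasDerivAt (fun x => chiTwist (S x)) 0 a := by
    rw [hasDerivAt_iff_isLittleO]
    simp only [smul_zero, sub_zero]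
    refine Asymptotics.IsLittleO.trans_isBigO (g := fun x => Φ x - Φ a) ?_ hΦ.isBigO_sub
    rw [Asymptotics.isLittleO_iff]
    intro ε hε
    obtain ⟨δ, h0, h⟩ := hflat.exists_dist_le hε
    filter_upwards [hf, Metric.continuousAt_iff'.1 hΦ.continuousAt δ h0] with x hx hxδ
    have := h (S x)
    rw [(hS x hx).1, hSa.1] at this
    exact this hxδ
  have hfin : ∀ᶠ x : ℝ in 𝓝 a, f (x : RHat) = ((Ψ (chiTwist (S x)) : ℝ) : RHat) := by
    filter_upwards [hf, hC.continuousAt.eventually_ne hne] with x hx hx'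
    exact (hS x hx).2 hx'
  refine ⟨?_, ?_⟩
  · filter_upwards [hfin] with x hx
    rw [hx]
    exact OnePoint.coe_ne_infty _
  · have h := (hΨ _ hne).hasDerivAt.comp a hC
    rw [mul_zero] at h
    refine h.congr_of_eventuallyEq ?_
    filter_upwards [hfin] with x hx
    rw [hx]
    rfl

lemma IsJimm.hasFiniteDerivAt_of_pos {f : RHat → RHat} (hf : IsJimm f) {a : ℝ} (ha : 0 < a)
    (h : ∀ s, chiPath s = 1 / (1 + a) → Flat s ∧ chiTwist s ≠ 0) : HasFiniteDerivAt f 0 a := by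
  refine hasFiniteDerivAt_of_flat (Φ := fun x => 1 / (1 + x)) (Ψ := fun y => 1 / y - 1) ?_
    (fun y hy => ?_) ?_ h
  · have : 1 + a ≠ 0 := by positivity
    fun_prop (disch := assumption)
  · fun_prop (disch := assumption)
  · filter_upwards [lt_mem_nhds ha] with x hx
    exact hf.exists_of_pos hx

lemma IsJimm.hasFiniteDerivAt_of_neg {f : RHat → RHat} (hf : IsJimm f) {a : ℝ} (ha : a < 0)
    (h : ∀ s, chiPath s = 1 - 1 / (1 - a) → Flat s ∧ chiTwist s ≠ 0) :
    HasFiniteDerivAt f 0 a := by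
  refine hasFiniteDerivAt_of_flat (Φ := fun x => 1 - 1 / (1 - x)) (Ψ := fun y => -(1 / y - 1)) ?_
    (fun y hy => ?_) ?_ h
  · have : 1 - a ≠ 0 := by linarith
    fun_prop (disch := assumption)
  · fun_prop (disch := assumption)
  · filter_upwards [gt_mem_nhds ha] with x hx
    exact hf.exists_of_neg hx

/-! ### The point sent to infinity, and the almost everywhere statement -/

lemma head_of_chiTwist_eq_zero {s : ℕ → Bool} (h : chiTwist s = 0) :
    s 0 = false ∧ chiTwist (shift 1 s) = 1 := by
  obtain ⟨h0, h1⟩ := chiTwist_mem (shift 1 s)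
  have e := chiTwist_eq s
  rw [h] at e
  cases hs : s 0
  · refine ⟨rfl, ?_⟩
    rw [hs, turnChi, eq_comm, div_eq_zero_iff] at e
    rcases e with e | e <;> linarith
  · rw [hs, turnChi, eq_comm, div_eq_zero_iff] at e
    rcases e with e | e <;> linarith

lemma head_of_chiTwist_eq_one {s : ℕ → Bool} (h : chiTwist s = 1) :
    s 0 = true ∧ chiTwist (shift 1 s) = 0 := by
  obtain ⟨h0, h1⟩ := chiTwist_mem (shift 1 s)
  have e := chiTwist_eq s
  rw [h] at e
  cases hs : s 0
  · rw [hs, turnChi, eq_div_iff (by linarith)] at e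
    linarith
  · refine ⟨rfl, ?_⟩
    rw [hs, turnChi, eq_div_iff (by linarith)] at e
    linarith

/-- The values 0 and 1 are attained only at end points of the turn maps, so each turn is forced and
the tails alternate between 0 and 1. Only one point of [0, 1] has to be discarded. -/
lemma eq_bodd_of_chiTwist_eq_zero {s : ℕ → Bool} (h : chiTwist s = 0) : s = Nat.bodd := by
  have key : ∀ n, s n = Nat.bodd n ∧ chiTwist (shift n s) = if Nat.bodd n then 1 else 0 := by
    intro n
    have next : ∀ m, chiTwist (shift m s) = (if Nat.bodd m then 1 else 0) →
        s m = Nat.bodd m ∧ chiTwist (shift (m + 1) s) = if Nat.bodd (m + 1) then 1 else 0 := by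
      intro m hm
      have e : shift m s 0 = s m := rfl
      rw [← e, ← shift_shift 1 m s, Nat.bodd_succ]
      cases hb : Nat.bodd m <;> simp only [hb, Bool.false_eq_true, if_true, if_false] at hm
      · simpa using head_of_chiTwist_eq_zero hm
      · simpa using head_of_chiTwist_eq_one hm
    have tail : chiTwist (shift n s) = if Nat.bodd n then 1 else 0 := by
      induction n with
      | zero => simpa [shift_zero] using h
      | succ n ih => exact (next n ih).2
    exact ⟨(next n tail).1, tail⟩
  exact funext fun n => (key n).1

lemma ae_flat_and_ne_zero : ∀ᵐ y : ℝ, ∀ s, chiPath s = y → Flat s ∧ chiTwist s ≠ 0 := by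
  have h : ∀ᵐ y : ℝ, y ≠ chiPath Nat.bodd := Measure.ae_ne volume _
  filter_upwards [ae_flat, h] with y hy hne s hs
  refine ⟨hy s hs, fun h0 => hne ?_⟩
  rw [← hs, eq_bodd_of_chiTwist_eq_zero h0]

theorem ae_hasFiniteDerivAt :
    ∀ᵐ a : ℝ, ∀ f : RHat → RHat, IsJimm f → HasFiniteDerivAt f 0 a := by
  set Z : Set ℝ := {y | ¬ ∀ s, chiPath s = y → Flat s ∧ chiTwist s ≠ 0} with hZ
  have hZ0 : volume Z = 0 := ae_flat_and_ne_zero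
  -- The null set is carried back by the inverse charts, which are differentiable away from their
  -- poles and so preserve null sets.
  have h1 : volume ((fun y : ℝ => 1 / y - 1) '' (Z ∩ {y | y ≠ 0})) = 0 := by
    refine addHaar_image_eq_zero_of_differentiableOn_of_addHaar_eq_zero _ ?_
      (measure_mono_null Set.inter_subset_left hZ0)
    rintro y ⟨-, hy : y ≠ 0⟩
    exact DifferentiableAt.differentiableWithinAt (by fun_prop (disch := assumption))
  have h2 : volume ((fun y : ℝ => 1 - 1 / (1 - y)) '' (Z ∩ {y | 1 - y ≠ 0})) = 0 := by
    refine addHaar_image_eq_zero_of_differentiableOn_of_addHaar_eq_zero _ ?_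
      (measure_mono_null Set.inter_subset_left hZ0)
    rintro y ⟨-, hy : 1 - y ≠ 0⟩
    exact DifferentiableAt.differentiableWithinAt (by fun_prop (disch := assumption))
  filter_upwards [measure_eq_zero_iff_ae_notMem.1 h1, measure_eq_zero_iff_ae_notMem.1 h2,
    Measure.ae_ne volume (0 : ℝ)] with a ha1 ha2 ha0 f hf
  rcases lt_or_gt_of_ne ha0 with h | h
  · refine hf.hasFiniteDerivAt_of_neg h ?_
    by_contra hc
    have h3 : 1 - a ≠ 0 := by linarith
    refine ha2 ⟨1 - 1 / (1 - a), ⟨hc, ?_⟩, ?_⟩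
    · simpa using h3
    · simp
  · refine hf.hasFiniteDerivAt_of_pos h ?_
    by_contra hc
    have h3 : 1 + a ≠ 0 := by linarith
    refine ha1 ⟨1 / (1 + a), ⟨hc, ?_⟩, ?_⟩
    · simpa using h3
    · simp

/-! ### The point [0, n, n, …]: growth over blocks of equal turns -/

lemma turnChi_eq_inv {b : Bool} {y ζ : ℝ} (hy : y ∈ Set.Icc (0 : ℝ) 1) (hζ : 1 < ζ)
    (h : turnChi b y = 1 / (1 + ζ)) : b = false ∧ y = 1 / (1 + (ζ - 1)) := by
  have h2 : 1 / (1 + ζ) < 1 / 2 := one_div_lt_one_div_of_lt two_pos (by linarith)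
  cases b
  · refine ⟨rfl, ?_⟩
    have : 0 < 1 + y := by linarith [hy.1]
    rw [turnChi, div_eq_div_iff this.ne' (by positivity)] at h
    rw [eq_div_iff (by linarith)]
    linarith
  · linarith [le_turnChi_true hy]

lemma turnChi_eq_one_sub_inv {b : Bool} {y ζ : ℝ} (hy : y ∈ Set.Icc (0 : ℝ) 1) (hζ : 1 < ζ)
    (h : turnChi b y = 1 - 1 / (1 + ζ)) : b = true ∧ y = 1 - 1 / (1 + (ζ - 1)) := by
  have h2 : 1 / (1 + ζ) < 1 / 2 := one_div_lt_one_div_of_lt two_pos (by linarith)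
  cases b
  · linarith [turnChi_false_le hy]
  · refine ⟨rfl, ?_⟩
    have h3 : 0 < 2 - y := by linarith [hy.2]
    have h4 : 1 + ζ ≠ 0 := by linarith
    have h5 : ζ ≠ 0 := by linarith
    have e : 1 - 1 / (1 + ζ) = ζ / (1 + ζ) := by field_simp; ring
    rw [turnChi, e, div_eq_div_iff h3.ne' h4] at h
    rw [add_sub_cancel]
    field_simp
    linarith

/-- The shape of a path towards `[0, n, n, …]` and of its transformations after `k` blocks of `n`
equal turns and `j` more turns, the letter of the current block being `b`. -/
structure BlockState (n : ℕ) (a : ℝ) (k j : ℕ) (b : Bool) (M M' : Moebius) (z : ℝ) : Prop where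
  point : z = cond b (1 - 1 / (1 + (n + a - j))) (1 / (1 + (n + a - j)))
  growth : ∃ x y : ℝ, 0 < x ∧ 0 < y ∧ x ≤ (n + 1 / n : ℝ) ^ (k + 1) ∧ y ≤ (n + 1 / n : ℝ) ^ k ∧
    cond b M.v M.u = x ∧ cond b M.u M.v = y + j * x
  fib : ∃ x y : ℝ, 0 < x ∧ 0 < y ∧ ((n : ℝ) ^ 2 + 3) ^ k ≤ x * y ∧
    cond b M'.v M'.u = Nat.fib (j + 1) * x + Nat.fib j * y ∧
    cond b M'.u M'.v = Nat.fib j * x + (Nat.fib (j + 1) - Nat.fib j) * y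
  twist : ((n : ℝ) ^ 2 + 3) ^ k ≤ M'.u * M'.v

/-- Within a block, plain turns add a fixed denominator x to the other one, whereas twisted turns
follow the Fibonacci recursion. The coefficient F_{j+1} - F_j stands for F_{j-1}, so that j = 0 is
covered. -/
lemma BlockState.next {n : ℕ} {a : ℝ} {k j : ℕ} {b : Bool} {M M' : Moebius} {s : ℕ → Bool}
    (ha : 0 < a) (hj : j < n) (hM' : M'.Pos) (h : BlockState n a k j b M M' (chiPath s)) :
    BlockState n a k (j + 1) b (M.turn (s 0)) (M'.twist (s 0)) (chiPath (shift 1 s)) := by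
  obtain ⟨h1, ⟨x, y, hx, hy, hxL, hyL, h2, h3⟩, ⟨X, Y, hX, hY, hXY, h4, h5⟩, h6⟩ := h
  have hjn : (j : ℝ) + 1 ≤ n := by exact_mod_cast hj
  have hζ : 1 < n + a - j := by linarith
  have hf : (Nat.fib (j + 1 + 1) : ℝ) = Nat.fib j + Nat.fib (j + 1) := by
    exact_mod_cast Nat.fib_add_two
  rw [chiPath_eq] at h1
  obtain ⟨hu, hv⟩ := hM'
  cases b
  · obtain ⟨e1, e2⟩ := turnChi_eq_inv (chiPath_mem _) hζ h1
    simp only [cond_false] at h2 h3 h4 h5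
    refine ⟨?_, ⟨x, y, hx, hy, hxL, hyL, ?_, ?_⟩, ⟨X, Y, hX, hY, hXY, ?_, ?_⟩, ?_⟩ <;>
      simp only [e1, e2, turn, Moebius.twist, cond_false]
    · push_cast; ring
    · exact h2
    · rw [h2, h3]; push_cast; ring
    · rw [h4, h5, hf]; ring
    · rw [h4, hf]; ring
    · nlinarith
  · obtain ⟨e1, e2⟩ := turnChi_eq_one_sub_inv (chiPath_mem _) hζ h1
    simp only [cond_true] at h2 h3 h4 h5
    refine ⟨?_, ⟨x, y, hx, hy, hxL, hyL, ?_, ?_⟩, ⟨X, Y, hX, hY, hXY, ?_, ?_⟩, ?_⟩ <;>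
      simp only [e1, e2, turn, Moebius.twist, cond_true]
    · push_cast; ring
    · exact h2
    · rw [h2, h3]; push_cast; ring
    · rw [h4, h5, hf]; ring
    · rw [h4, hf]; ring
    · nlinarith

/-- The coefficient of xy on the right is F_n² + F_{n+1} F_{n-1}, and the other terms are
nonnegative. The assumption n > 4 gives F_n ≥ n and F_{n-1} ≥ 3. -/
lemma fib_block_bound {n : ℕ} (hn : 4 < n) {x y : ℝ} (hx : 0 < x) (hy : 0 < y) :
    ((n : ℝ) ^ 2 + 3) * (x * y) ≤ (Nat.fib (n + 1) * x + Nat.fib n * y) *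
      (Nat.fib n * x + (Nat.fib (n + 1) - Nat.fib n) * y) := by
  obtain ⟨m, rfl⟩ : ∃ m, n = m + 1 := ⟨n - 1, by omega⟩
  have h1 : ((m + 1 : ℕ) : ℝ) ≤ Nat.fib (m + 1) := by exact_mod_cast Nat.le_fib_self (by omega)
  have h2 : (3 : ℝ) ≤ Nat.fib m := by
    have : Nat.fib 4 ≤ Nat.fib m := Nat.fib_mono (by omega)
    exact_mod_cast this
  have h3 : (Nat.fib (m + 1 + 1) : ℝ) = Nat.fib m + Nat.fib (m + 1) := by
    exact_mod_cast Nat.fib_add_two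
  rw [h3]
  have h0 : (0 : ℝ) ≤ ((m + 1 : ℕ) : ℝ) := Nat.cast_nonneg _
  generalize ((m + 1 : ℕ) : ℝ) = N at *
  generalize (Nat.fib (m + 1) : ℝ) = F at *
  generalize (Nat.fib m : ℝ) = G at *
  have hxy := mul_pos hx hy
  have e : (((G + F) * x + F * y) * (F * x + (G + F - F) * y)) =
      (F ^ 2 + (G + F) * G) * (x * y) + ((G + F) * F * x ^ 2 + F * G * y ^ 2) := by ring
  have hF : 0 ≤ F := h0.trans h1
  have hG : 0 ≤ G := by linarith
  have hq : 0 ≤ (G + F) * F * x ^ 2 + F * G * y ^ 2 := by positivity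
  have hc : N ^ 2 + 3 ≤ F ^ 2 + (G + F) * G := by nlinarith [pow_le_pow_left₀ h0 h1 2]
  rw [e]
  nlinarith [mul_le_mul_of_nonneg_right hc hxy.le]

lemma BlockState.switch {n : ℕ} {a : ℝ} {k : ℕ} {b : Bool} {M M' : Moebius} {z : ℝ} (hn : 4 < n)
    (ha : 0 < a) (ha' : a * (n + a) = 1) (h : BlockState n a k n b M M' z) :
    BlockState n a (k + 1) 0 (!b) M M' z := by
  obtain ⟨h1, ⟨x, y, hx, hy, hxL, hyL, h2, h3⟩, ⟨X, Y, hX, hY, hXY, h4, h5⟩, h6⟩ := h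
  have hn0 : (0 : ℝ) < n := by exact_mod_cast (by omega : 0 < n)
  set L : ℝ := n + 1 / n with hL
  have hL0 : 0 < L := by positivity
  have hprod : (cond b M'.v M'.u) * (cond b M'.u M'.v) = M'.u * M'.v := by
    cases b <;> simp [mul_comm]
  have hbig : ((n : ℝ) ^ 2 + 3) ^ (k + 1) ≤ M'.u * M'.v := by
    rw [← hprod, h4, h5]
    refine le_trans ?_ (fib_block_bound hn hX hY)
    rw [pow_succ']
    exact mul_le_mul_of_nonneg_left hXY (by positivity)
  have hfib : (Nat.fib n : ℝ) ≤ Nat.fib (n + 1) := by exact_mod_cast Nat.fib_le_fib_succ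
  have hfib0 : (0 : ℝ) < Nat.fib n := by exact_mod_cast Nat.fib_pos.2 (by omega)
  have p4 : 0 < cond b M'.v M'.u := by
    rw [h4]
    have : (0 : ℝ) < Nat.fib (n + 1) := hfib0.trans_le hfib
    positivity
  have p5 : 0 < cond b M'.u M'.v := by
    rw [h5]
    have := sub_nonneg.2 hfib
    positivity
  refine ⟨?_, ⟨cond b M.u M.v, cond b M.v M.u, ?_, h2 ▸ hx, ?_, ?_, ?_, ?_⟩,
    ⟨cond b M'.u M'.v, cond b M'.v M'.u, p5, p4, ?_, ?_, ?_⟩, hbig⟩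
  · have d1 : 1 + a ≠ 0 := by positivity
    have d2 : 1 + (n + a) ≠ 0 := by positivity
    have e : 1 / (1 + a) = 1 - 1 / (1 + (n + a)) := by
      field_simp
      linear_combination -ha'
    rw [h1, add_sub_cancel_left, Nat.cast_zero, sub_zero]
    cases b <;> simp only [cond_true, cond_false, Bool.not_true, Bool.not_false]
    · exact e
    · linarith
  · rw [h3]
    positivity
  · rw [h3]
    have e : L ^ (k + 1 + 1) = L ^ k * L ^ 2 := by ring
    have e' : L ^ (k + 1) = L ^ k * L := by ring
    -- The actual growth rate n + a is the positive root of λ² = nλ + 1; L = n + 1/n exceeds it,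
    -- whence this inequality.
    have hLL : 1 + n * L ≤ L ^ 2 := by
      have : L ^ 2 = n * L + (1 + 1 / n ^ 2) := by rw [hL]; field_simp
      rw [this]
      have : (0 : ℝ) ≤ 1 / n ^ 2 := by positivity
      linarith
    calc y + n * x ≤ L ^ k + n * L ^ (k + 1) := by gcongr
      _ = L ^ k * (1 + n * L) := by rw [e']; ring
      _ ≤ L ^ k * L ^ 2 := by gcongr
      _ = _ := e.symm
  · rw [h2]
    exact hxL
  · cases b <;> rfl
  · cases b <;> simp
  · rw [mul_comm, hprod]
    exact hbig
  · cases b <;> simp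
  · cases b <;> simp

lemma exists_blockState {n : ℕ} {a : ℝ} {s : ℕ → Bool} (hn : 4 < n) (ha : 0 < a)
    (ha' : a * (n + a) = 1) (hs : chiPath s = 1 / (1 + a)) (k j : ℕ) (hj : j ≤ n) :
    ∃ b, BlockState n a k j b (run turn start s (n * k + j)) (run Moebius.twist start s (n * k + j))
      (chiPath (shift (n * k + j) s)) := by
  have inner : ∀ k j, (∃ b, BlockState n a k 0 b (run turn start s (n * k))
      (run Moebius.twist start s (n * k)) (chiPath (shift (n * k) s))) → j ≤ n →
      ∃ b, BlockState n a k j b (run turn start s (n * k + j))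
      (run Moebius.twist start s (n * k + j)) (chiPath (shift (n * k + j) s)) := by
    intro k j h0 hj
    induction j with
    | zero => exact h0
    | succ j ih =>
      obtain ⟨b, hb⟩ := ih (by omega)
      refine ⟨b, ?_⟩
      have := hb.next ha (by omega) (pos_start.run_twist s _)
      rwa [shift_shift] at this
  have outer : ∀ k, ∃ b, BlockState n a k 0 b (run turn start s (n * k))
      (run Moebius.twist start s (n * k)) (chiPath (shift (n * k) s)) := by
    intro k
    induction k with
    | zero =>
      refine ⟨true, ⟨?_, ⟨1, 1, one_pos, one_pos, ?_, ?_, ?_, ?_⟩, ⟨1, 1, one_pos, one_pos, ?_, ?_, ?_⟩, ?_⟩⟩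
      · have d1 : 1 + a ≠ 0 := by positivity
        have d2 : 1 + (n + a) ≠ 0 := by positivity
        rw [mul_zero, shift_zero, hs, Nat.cast_zero, sub_zero, cond_true]
        field_simp
        linear_combination -ha'
      · have : (1 : ℝ) ≤ n := by exact_mod_cast (by omega : 1 ≤ n)
        have : (0 : ℝ) ≤ 1 / n := by positivity
        rw [zero_add, pow_one]
        linarith
      all_goals simp [run, start]
    | succ k ih =>
      obtain ⟨b, hb⟩ := inner k n ih le_rfl
      exact ⟨!b, by simpa [mul_add] using hb.switch hn ha ha'⟩
  exact inner k j (outer k) hj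

lemma BlockState.le_abs_sub {n : ℕ} {a : ℝ} {k j : ℕ} {b : Bool} {M M' : Moebius} {z : ℝ}
    (ha : 0 < a) (hj : j < n) (hM : M.Pos) (hd : M.det = 1) (hz : z ∈ Set.Icc (0 : ℝ) 1)
    (h : BlockState n a k j b M M' z) :
    (1 / 2 - 1 / (2 + a)) / ((n + 2) * (n + 1 / n : ℝ) ^ (k + 1)) ^ 2 ≤
      |M.eval z - M.eval (1 / 2)| := by
  obtain ⟨h1, ⟨x, y, hx, hy, hxL, hyL, h2, h3⟩, -, -⟩ := h
  have hjn : (j : ℝ) + 1 ≤ n := by exact_mod_cast hj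
  have hn1 : (1 : ℝ) ≤ n := by linarith [(Nat.cast_nonneg j : (0 : ℝ) ≤ j)]
  set L : ℝ := n + 1 / n with hL
  have hL1 : 1 ≤ L := by
    have : (0 : ℝ) ≤ 1 / n := by positivity
    linarith
  have hsum : M.u + M.v ≤ (n + 2) * L ^ (k + 1) := by
    have e : M.u + M.v = x + (y + j * x) := by
      rw [← h3, ← h2]
      cases b <;> simp [add_comm]
    have hy' : y ≤ L ^ (k + 1) := hyL.trans (pow_le_pow_right₀ hL1 k.le_succ)
    have : (j : ℝ) * x ≤ n * L ^ (k + 1) := by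
      apply mul_le_mul (by linarith) hxL hx.le (by positivity)
    rw [e]
    linarith
  have half : (1 / 2 : ℝ) ∈ Set.Icc (0 : ℝ) 1 := by norm_num
  have hden : ∀ w ∈ Set.Icc (0 : ℝ) 1, M.u * (1 - w) + M.v * w ≤ (n + 2) * L ^ (k + 1) := by
    rintro w ⟨hw0, hw1⟩
    obtain ⟨hu, hv⟩ := hM
    nlinarith [mul_nonneg hu.le hw0, mul_nonneg hv.le (sub_nonneg.2 hw1)]
  -- As j < n, the remaining value n + a - j is at least 1 + a, which keeps z away from 1/2
  -- uniformly.
  have hzd : 1 / 2 - 1 / (2 + a) ≤ |z - 1 / 2| := by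
    have : 1 / (1 + (n + a - j)) ≤ 1 / (2 + a) :=
      one_div_le_one_div_of_le (by linarith) (by linarith)
    rw [h1]
    cases b
    · rw [cond_false, abs_sub_comm]
      exact le_trans (by linarith) (le_abs_self _)
    · rw [cond_true]
      exact le_trans (by linarith) (le_abs_self _)
  rw [hM.eval_sub_eval hz half, hd, one_mul, abs_div,
    abs_of_pos (mul_pos (hM.denom_pos hz) (hM.denom_pos half)), sq]
  exact div_le_div₀ (abs_nonneg _) hzd (mul_pos (hM.denom_pos hz) (hM.denom_pos half))
    (mul_le_mul (hden z hz) (hden _ half) (hM.denom_pos half).le (by positivity))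

lemma flat_of_chiPath_eq {n : ℕ} {a : ℝ} {s : ℕ → Bool} (hn : 4 < n) (ha : 0 < a)
    (ha' : a * (n + a) = 1) (hs : chiPath s = 1 / (1 + a)) : Flat s := by
  have hn1 : (1 : ℝ) ≤ n := by exact_mod_cast (by omega : 1 ≤ n)
  set L : ℝ := n + 1 / n with hL
  have hL0 : 0 < L := by positivity
  set δ : ℝ := 1 / 2 - 1 / (2 + a) with hδ
  have hδ0 : 0 < δ := sub_pos.2 (one_div_lt_one_div_of_lt two_pos (by linarith))
  have key : ∀ m, δ / ((n + 2) * L ^ (m / n + 1)) ^ 2 ≤ |chiPath s - midpoint s m| ∧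
      twistLength s m ≤ 1 / ((n : ℝ) ^ 2 + 3) ^ (m / n) := by
    intro m
    have hm := Nat.mod_lt m (by omega : 0 < n)
    obtain ⟨b, hb⟩ := exists_blockState hn ha ha' hs (m / n) (m % n) hm.le
    rw [Nat.div_add_mod] at hb
    refine ⟨?_, one_div_le_one_div_of_le (by positivity) hb.twist⟩
    have := hb.le_abs_sub ha hm (pos_start.run_turn s m) (by rw [det_run_turn, det_start])
      (chiPath_mem _)
    rwa [eval_run_turn chiPath_mem chiPath_eq, eval_start] at this
  refine ⟨fun m hm => ?_, fun K => ?_⟩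
  · have h := (key m).1
    rw [hm, sub_self, abs_zero] at h
    have : 0 < δ / ((n + 2) * L ^ (m / n + 1)) ^ 2 := by positivity
    linarith
  -- The decisive comparison of rates: L² = n² + 2 + 1/n² < n² + 3.
  · have hr : L ^ 2 / ((n : ℝ) ^ 2 + 3) < 1 := by
      rw [div_lt_one (by positivity)]
      have e : L ^ 2 = n ^ 2 + 2 + 1 / n ^ 2 := by rw [hL]; field_simp; ring
      have : (1 : ℝ) / n ^ 2 < 1 := by
        rw [div_lt_one (by positivity)]
        have : (4 : ℝ) < n := by exact_mod_cast hn
        nlinarith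
      linarith
    have ht : Tendsto (fun m : ℕ => K * ((n + 2) * L) ^ 2 * (L ^ 2 / ((n : ℝ) ^ 2 + 3)) ^ (m / n))
        atTop (𝓝 (K * ((n + 2) * L) ^ 2 * 0)) :=
      ((tendsto_pow_atTop_nhds_zero_of_lt_one (by positivity) hr).comp
        (Nat.tendsto_div_const_atTop (by omega))).const_mul _
    rw [mul_zero] at ht
    filter_upwards [ht.eventually_lt_const hδ0] with m hm
    obtain ⟨h1, h2⟩ := key m
    refine lt_of_le_of_lt (mul_le_mul_of_nonneg_left h2 K.cast_nonneg) (lt_of_lt_of_le ?_ h1)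
    rw [lt_div_iff₀ (by positivity)]
    refine lt_of_eq_of_lt ?_ hm
    rw [div_pow, ← pow_mul]
    ring

/-! ### Identification of the continued fraction -/

lemma tendsto_constContFract {n : ℕ} {a : ℝ} (hn : 1 < n) (ha : 0 < a) (ha' : a * (n + a) = 1) :
    Tendsto (fun k : ℕ => (constContFract n).convs' k) atTop (𝓝 a) := by
  have hn1 : (1 : ℝ) < n := by exact_mod_cast hn
  have h0 : (constContFract n).convs' 0 = 0 := by
    rw [GenContFract.zeroth_conv'_eq_h]; rfl
  have hsucc : ∀ k, (constContFract n).convs' (k + 1) = 1 / (n + (constContFract n).convs' k) := by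
    intro k
    simp only [GenContFract.convs', constContFract, zero_add]
    rw [GenContFract.convs'Aux_succ_some (p := ⟨1, (n : ℝ)⟩) rfl]
    rfl
  have hnn : ∀ k, 0 ≤ (constContFract n).convs' k := by
    intro k
    induction k with
    | zero => rw [h0]
    | succ k ih => rw [hsucc]; positivity
  -- The limit a is a fixed point of x ↦ 1/(n + x), which shrinks distances to a by (n + x)(n + a) ≥
  -- n.
  have hb : ∀ k, |(constContFract n).convs' k - a| ≤ (1 / n : ℝ) ^ k * a := by
    intro k
    induction k with
    | zero => rw [h0, zero_sub, abs_neg, abs_of_pos ha]; simp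
    | succ k ih =>
      have hk := hnn k
      rw [hsucc]
      generalize (constContFract n).convs' k = x at *
      have d1 : 0 < n + x := by positivity
      have d2 : 0 < n + a := by positivity
      have e : 1 / (n + x) - a = -((x - a) / ((n + x) * (n + a))) := by
        have : a = 1 / (n + a) := by rw [eq_div_iff d2.ne']; exact ha'
        calc 1 / (n + x) - a = 1 / (n + x) - 1 / (n + a) := by rw [← this]
          _ = _ := by field_simp; ring
      rw [e, abs_neg, abs_div, abs_of_pos (mul_pos d1 d2), pow_succ', mul_assoc, one_div_mul_eq_div]
      exact div_le_div₀ (by positivity) ih (by positivity) (by nlinarith)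
  rw [tendsto_iff_dist_tendsto_zero]
  refine squeeze_zero (fun _ => dist_nonneg) hb ?_
  have := (tendsto_pow_atTop_nhds_zero_of_lt_one (r := 1 / (n : ℝ)) (by positivity)
    ((div_lt_one (by positivity)).2 hn1)).mul_const a
  rwa [zero_mul] at this

lemma exists_pos_root (n : ℕ) : ∃ a : ℝ, 0 < a ∧ a * (n + a) = 1 := by
  have h := Real.sq_sqrt (show (0 : ℝ) ≤ (n : ℝ) ^ 2 + 4 by positivity)
  refine ⟨(√((n : ℝ) ^ 2 + 4) - n) / 2, ?_, by nlinarith⟩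
  have : (n : ℝ) < √((n : ℝ) ^ 2 + 4) := Real.lt_sqrt_of_sq_lt (by linarith)
  linarith

/-- The image is infinite only if the first turn is left, which would force a ≥ 1. -/
lemma chiTwist_ne_zero_of_lt_one {s : ℕ → Bool} {a : ℝ} (ha : 0 < a) (ha1 : a < 1)
    (hs : chiPath s = 1 / (1 + a)) : chiTwist s ≠ 0 := by
  intro h
  have hf := (head_of_chiTwist_eq_zero h).1
  have h1 := turnChi_false_le (chiPath_mem (shift 1 s))
  rw [← hf, ← chiPath_eq, hs] at h1
  have : 1 / 2 < 1 / (1 + a) := one_div_lt_one_div_of_lt (by positivity) (by linarith)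
  linarith

end Jimm

theorem mainTheorem1 :
    (∀ᵐ a : ℝ ∂volume, ∀ f : Jimm.RHat → Jimm.RHat, Jimm.IsJimm f →
      Jimm.HasFiniteDerivAt f 0 a) ∧
    (∀ n : ℕ, 4 < n → ∃ a : ℝ,
      Tendsto (fun k : ℕ => (Jimm.constContFract n).convs' k) atTop (𝓝 a) ∧
      ∀ f : Jimm.RHat → Jimm.RHat, Jimm.IsJimm f → Jimm.HasFiniteDerivAt f 0 a) := by
  refine ⟨Jimm.ae_hasFiniteDerivAt, fun n hn => ?_⟩
  obtain ⟨a, ha, ha'⟩ := Jimm.exists_pos_root n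
  have hn1 : (4 : ℝ) < n := by exact_mod_cast hn
  refine ⟨a, Jimm.tendsto_constContFract (by omega) ha ha', fun f hf =>
    hf.hasFiniteDerivAt_of_pos ha fun s hs => ⟨Jimm.flat_of_chiPath_eq hn ha ha' hs,
      Jimm.chiTwist_ne_zero_of_lt_one ha (by nlinarith) hs⟩⟩
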